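/- **Lemma (Number of filter vectors).** For a probability vector $p$ let $H(p)=-\sum_i p_i\log_2 p_i$. Fix reals $\alpha,\beta,\gamma\in[0,\tfrac12]$ with $|\alpha-\beta|\le\gamma<\alpha+\beta$. Define $p(\alpha,\beta,\gamma)\in\mathbb R^8$ by $$p_{000}=p_{111}=\tfrac12-\tfrac14(\gamma+\beta+\alpha),\quad p_{001}=p_{110}=\tfrac14(\gamma+\beta-\alpha),\quad p_{010}=p_{101}=\tfrac14(\gamma+\alpha-\beta),\quad p_{100}=p_{011}=\tfrac14(\beta+\alpha-\gamma),$$ and $p(\gamma)\in\mathbb R^4$ by $p_{00}=p_{11}=\tfrac{1-\gamma}2$, $p_{01}=p_{10}=\tfrac\gamma2$, and put $$\rho=1-\bigl(H(p(\alpha,\beta,\gamma))-H(p(\gamma))\bigr).$$ Locality-sensitive filtering with $M$ filter vectors works as follows. Let $C=(c_1,\dots,c_M)$ be independent uniform vectors in $\mathbb F_2^n$, and let $\mathrm{dist}$ be the Hamming distance. For a list $L$ of vectors in $\mathbb F_2^n$, every $v\in L$ is inserted into the bucket of each $c_i$ with $\mathrm{dist}(c_i,v)\le\alpha n$. $\mathrm{Query}(q)$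 goes through the buckets of all $c_i$ with $\mathrm{dist}(c_i,q)\le\beta n$ and returns all vectors $v$ found there with $\mathrm{dist}(v,q)\le\gamma n$. Then: 1. $p(\alpha,\beta,\gamma)$ and $p(\gamma)$ are probability vectors. 2. (Sufficiency, for all distances up to $\gamma n$.) There are numbers $M_n=2^{(\rho+o(1))n}$ such that with $M_n$ filter vectors the error is super-exponentially small: for every $K\in\mathbb R$ and all sufficiently large $n$, for every list $L$ and every query $q$ in $\mathbb F_2^n$, $$\Pr_C\bigl[\mathrm{Query}(q)\text{ misses some } v\in L \text{ with } \mathrm{dist}(v,q)\le\gamma n\bigr]\le 2^{-Kn}.$$ 3. (Necessity.) Suppose in addition that $|\alpha-\beta|\le\gamma\,(1-2\min(\alpha,\beta))$. Then for every $\varepsilon>0$, all sufficiently large $n$ and every $M\le 2^{(\rho-\varepsilon)n}$, for every list $L$, every $v\in L$ and every $q$ with $\mathrm{dist}(v,q)=\lfloor\gamma n\rfloor$, with $M$ filter vectors $$\Pr_C\bigl[v\in\mathrm{Query}(q)\bigr]\le 2^{-\varepsilon n/2}.$$ -/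

import Mathlib

open Filter Topology

/-- The Shannon entropy (in bits) of a vector `p` indexed by a finite type. -/
noncomputable def entropy {ι : Type*} [Fintype ι] (p : ι → ℝ) : ℝ :=
  -∑ i, p i * Real.logb 2 (p i)

/-- `p` is a probability vector. -/
def IsProbVector {ι : Type*} [Fintype ι] (p : ι → ℝ) : Prop :=
  (∀ i, 0 ≤ p i ∧ p i ≤ 1) ∧ ∑ i, p i = 1

/-- The balanced distribution `p(α, β, γ)` of a triple (filter vector, stored vector, query):
first and second entries differ with weight `α`, first and third with weight `β`,
second and third with weight `γ`. -/
noncomputable def balancedTriple (α β γ : ℝ) : Fin 2 × Fin 2 × Fin 2 → ℝ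
  | (0, 0, 0) => 1 / 2 - (γ + β + α) / 4
  | (1, 1, 1) => 1 / 2 - (γ + β + α) / 4
  | (0, 0, 1) => (γ + β - α) / 4
  | (1, 1, 0) => (γ + β - α) / 4
  | (0, 1, 0) => (γ + α - β) / 4
  | (1, 0, 1) => (γ + α - β) / 4
  | (1, 0, 0) => (β + α - γ) / 4
  | (0, 1, 1) => (β + α - γ) / 4

/-- The balanced distribution `p(γ)` of a pair of vectors at relative distance `γ`. -/
noncomputable def balancedPair (γ : ℝ) : Fin 2 × Fin 2 → ℝ
  | (0, 0) => (1 - γ) / 2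
  | (1, 1) => (1 - γ) / 2
  | (1, 0) => γ / 2
  | (0, 1) => γ / 2

/-- The exponent `1 - (H(p(α, β, γ)) - H(p(γ)))`. -/
noncomputable def filterExponent (α β γ : ℝ) : ℝ :=
  1 - (entropy (balancedTriple α β γ) - entropy (balancedPair γ))

namespace LSF

/-- Binary vectors of length `n`. -/
abbrev Vec (n : ℕ) : Type := Fin n → ZMod 2

/-- `x` and `y` are at Hamming distance at most `δ n`. -/
def Close {n : ℕ} (δ : ℝ) (x y : Vec n) : Prop := (hammingDist x y : ℝ) ≤ δ * n

/-- The LSF data structure for `M` filter vectors: one bucket for each of them. -/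
abbrev Buckets (n M : ℕ) : Type := Fin M → Finset (Vec n)

open Classical in
/-- Insertion of `x` with parameter `α`: `x` is added to the bucket of every filter vector
that is `α`-close to it. -/
noncomputable def insert {n M : ℕ} (α : ℝ) (C : Fin M → Vec n) (D : Buckets n M) (x : Vec n) :
    Buckets n M :=
  fun i => if Close α (C i) x then D i ∪ {x} else D i

/-- Preprocessing: starting from empty buckets, insert all elements of the list. -/
noncomputable def preprocess {n M : ℕ} (α : ℝ) (C : Fin M → Vec n) (L : List (Vec n)) :
    Buckets n M :=
  L.foldl (insert α C) (fun _ => ∅)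

open Classical in
/-- The query procedure with query parameter `β` and target distance `γ`: search the buckets of
all filter vectors `β`-close to `q`, and return the vectors in them that are `γ`-close to `q`. -/
noncomputable def query {n M : ℕ} (β γ : ℝ) (C : Fin M → Vec n) (D : Buckets n M) (q : Vec n) :
    Finset (Vec n) :=
  (Finset.univ.filter fun i => Close β (C i) q).biUnion
    fun i => (D i).filter fun x => Close γ x q

/-- The probability of an event when the `M` filter vectors are independent and uniform in
`𝔽₂ⁿ`, that is, when the family of filter vectors is uniform. -/
noncomputable def prob {n M : ℕ} (E : Set (Fin M → Vec n)) : ℝ :=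
  ((PMF.uniformOfFintype (Fin M → Vec n)).toOuterMeasure E).toReal

end LSF

/-! A stored vector `v` within `γ n` of `q` is returned exactly when some filter vector lies in the
wedge, the intersection of the ball of radius `α n` about `v` with that of radius `β n` about `q`.
By independence the miss probability is `(1 - |wedge| / 2 ^ n) ^ M`, so everything reduces to
showing that the wedge has size `exp (wedgeRate * n + o(n))`, where `1 - wedgeRate / log 2` is the
filter exponent (`filterExponent_eq`).

From below, count the centres that make prescribed numbers of changes to `v` inside and outside the
set where `v` and `q` differ: this gives a product of two binomials, evaluated by Stirling
(`exists_le_card_wedge`). Wedges do not grow as `q` moves away from `v` (`card_wedge_update_le`), so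
the extreme distance covers all smaller ones. From above, use a two-parameter Chernoff bound
(`card_wedge_le`). Its optimal parameters are at most `1` precisely under the extra hypothesis of
the necessity part (`exists_chernoff_parameters`). -/

namespace LSF

/-! ### Reduction of hit and miss probabilities to wedge sizes. -/

open Classical in
/-- The filter vectors that are `α`-close to `v` and `β`-close to `q`. -/
noncomputable def wedge {n : ℕ} (α β : ℝ) (v q : Vec n) : Finset (Vec n) :=
  Finset.univ.filter fun c => Close α c v ∧ Close β c q

lemma mem_wedge {n : ℕ} {α β : ℝ} {v q c : Vec n} :
    c ∈ wedge α β v q ↔ Close α c v ∧ Close β c q := by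
  simp [wedge]

lemma mem_foldl_insert {n M : ℕ} (α : ℝ) (C : Fin M → Vec n) (L : List (Vec n))
    (D : Buckets n M) (v : Vec n) (i : Fin M) :
    v ∈ L.foldl (insert α C) D i ↔ v ∈ D i ∨ v ∈ L ∧ Close α (C i) v := by
  induction L generalizing D with
  | nil => simp
  | cons x L ih =>
    rw [List.foldl_cons, ih]
    by_cases h : Close α (C i) x
    · simp only [insert, h, if_true, Finset.mem_union, Finset.mem_singleton, List.mem_cons]
      constructor
      · rintro ((h1 | rfl) | h2)
        · exact Or.inl h1
        · exact Or.inr ⟨Or.inl rfl, h⟩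
        · exact Or.inr ⟨Or.inr h2.1, h2.2⟩
      · tauto
    · simp only [insert, h, if_false, List.mem_cons]
      constructor
      · tauto
      · rintro (h1 | ⟨rfl | h2, h3⟩)
        · exact Or.inl h1
        · exact absurd h3 h
        · exact Or.inr ⟨h2, h3⟩

lemma mem_query {n M : ℕ} {α β γ : ℝ} {C : Fin M → Vec n} {L : List (Vec n)} {v q : Vec n} :
    v ∈ query β γ C (preprocess α C L) q ↔
      v ∈ L ∧ Close γ v q ∧ ∃ i, C i ∈ wedge α β v q := by
  simp only [query, preprocess, Finset.mem_biUnion, Finset.mem_filter, Finset.mem_univ, true_and,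
    mem_foldl_insert, Finset.notMem_empty, false_or, mem_wedge]
  constructor
  · rintro ⟨i, h1, ⟨h2, h3⟩, h4⟩
    exact ⟨h2, h4, i, h3, h1⟩
  · rintro ⟨h2, h4, i, h3, h1⟩
    exact ⟨i, h1, ⟨h2, h3⟩, h4⟩

lemma prob_eq_card_div {n M : ℕ} (E : Set (Fin M → Vec n)) [DecidablePred (· ∈ E)] :
    prob E = ((Finset.univ.filter fun C => C ∈ E).card : ℝ) / (2 ^ n) ^ M := by
  classical
  rw [prob, PMF.toOuterMeasure_uniformOfFintype_apply, ENNReal.toReal_div,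
    Fintype.card_subtype]
  simp [ZMod.card]

lemma prob_mono {n M : ℕ} {E F : Set (Fin M → Vec n)} (h : E ⊆ F) : prob E ≤ prob F := by
  classical
  rw [prob_eq_card_div, prob_eq_card_div]
  gcongr

lemma prob_exists_le {n M : ℕ} {ι : Type*} (S : Finset ι) (E : ι → Set (Fin M → Vec n)) :
    prob {C | ∃ v ∈ S, C ∈ E v} ≤ ∑ v ∈ S, prob (E v) := by
  classical
  have hE : ∀ E : Set (Fin M → Vec n), prob E =
      ((Finset.univ.filter fun C => C ∈ E).card : ℝ) / (2 ^ n) ^ M := fun E => prob_eq_card_div E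
  simp_rw [hE]
  rw [← Finset.sum_div]
  gcongr
  have h := Finset.card_biUnion_le (s := S)
    (t := fun v => Finset.univ.filter fun C : Fin M → Vec n => C ∈ E v)
  have h2 : (Finset.univ.filter fun C : Fin M → Vec n => C ∈ {C | ∃ v ∈ S, C ∈ E v}) =
      S.biUnion fun v => Finset.univ.filter fun C : Fin M → Vec n => C ∈ E v := by
    ext C; simp
  refine le_trans (le_of_eq ?_) (Nat.cast_le.2 h |>.trans (le_of_eq (Nat.cast_sum _ _)))
  rw [← h2]
  congr!

lemma prob_forall_notMem {n M : ℕ} (G : Finset (Vec n)) :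
    prob {C : Fin M → Vec n | ∀ i, C i ∉ G} = (1 - (G.card : ℝ) / 2 ^ n) ^ M := by
  classical
  have h : (Finset.univ.filter fun C : Fin M → Vec n => C ∈ {C : Fin M → Vec n | ∀ i, C i ∉ G}) =
      Fintype.piFinset fun _ => Gᶜ := by
    ext C; simp [Fintype.mem_piFinset]
  have hG : G.card ≤ 2 ^ n := by
    simpa [ZMod.card] using Finset.card_le_univ G
  have hE : prob {C : Fin M → Vec n | ∀ i, C i ∉ G} = ((Finset.univ.filter fun C =>
      C ∈ {C : Fin M → Vec n | ∀ i, C i ∉ G}).card : ℝ) / (2 ^ n) ^ M := prob_eq_card_div _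
  rw [hE, h, Fintype.card_piFinset, Finset.prod_const, Finset.card_compl,
    Finset.card_univ, Fintype.card_fin]
  simp only [Fintype.card_pi, ZMod.card, Finset.prod_const, Finset.card_univ, Fintype.card_fin,
    Nat.cast_pow]
  have : (2 : ℝ) ^ n ≠ 0 := by positivity
  rw [Nat.cast_sub hG, ← div_pow]
  congr 1
  push_cast
  field_simp

lemma prob_compl {n M : ℕ} (E : Set (Fin M → Vec n)) : prob Eᶜ = 1 - prob E := by
  classical
  rw [prob_eq_card_div, prob_eq_card_div, eq_sub_iff_add_eq, ← add_div, div_eq_one_iff_eq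
    (by positivity)]
  have := Finset.card_filter_add_card_filter_not (s := (Finset.univ : Finset (Fin M → Vec n)))
    (fun C => C ∈ E)
  simp only [Set.mem_compl_iff]
  rw [add_comm]
  have h2 : (Finset.univ : Finset (Fin M → Vec n)).card = (2 ^ n) ^ M := by
    simp [ZMod.card]
  rw [h2] at this
  exact_mod_cast this

lemma prob_exists_mem_le {n M : ℕ} (G : Finset (Vec n)) :
    prob {C : Fin M → Vec n | ∃ i, C i ∈ G} ≤ M * ((G.card : ℝ) / 2 ^ n) := by
  have h : {C : Fin M → Vec n | ∃ i, C i ∈ G} = {C : Fin M → Vec n | ∀ i, C i ∉ G}ᶜ := by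
    ext C; simp
  have hG : (G.card : ℝ) / 2 ^ n ≤ 1 := by
    rw [div_le_one (by positivity)]
    have : G.card ≤ 2 ^ n := by simpa [ZMod.card] using Finset.card_le_univ G
    exact_mod_cast this
  rw [h, prob_compl, prob_forall_notMem]
  have := one_add_mul_le_pow (a := -((G.card : ℝ) / 2 ^ n)) (by linarith) M
  rw [sub_eq_add_neg 1 ((G.card : ℝ) / 2 ^ n)]
  linarith

/-- The union bound runs over the whole space rather than over `L`, so the estimate does not depend
on the length of the list. -/
lemma prob_miss_le {n M : ℕ} {α β γ B : ℝ} (L : List (Vec n)) (q : Vec n)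
    (hB : ∀ v, Close γ v q → (1 - ((wedge α β v q).card : ℝ) / 2 ^ n) ^ M ≤ B) (hB0 : 0 ≤ B) :
    prob {C : Fin M → Vec n | ¬ ∀ v ∈ L, Close γ v q → v ∈ query β γ C (preprocess α C L) q}
      ≤ 2 ^ n * B := by
  classical
  calc _ ≤ prob {C : Fin M → Vec n | ∃ v ∈ Finset.univ.filter (fun v => Close γ v q),
              C ∈ {C : Fin M → Vec n | ∀ i, C i ∉ wedge α β v q}} := by
        refine prob_mono fun C hC => ?_
        simp only [Set.mem_ofPred_eq] at hC ⊢
        push Not at hC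
        obtain ⟨v, hv, hvq, hn⟩ := hC
        refine ⟨v, by simpa using hvq, fun i hi => hn ?_⟩
        exact mem_query.2 ⟨hv, hvq, i, hi⟩
    _ ≤ ∑ v ∈ Finset.univ.filter (fun v => Close γ v q), B := by
        refine (prob_exists_le _ _).trans (Finset.sum_le_sum fun v hv => ?_)
        rw [prob_forall_notMem]
        exact hB v (by simpa using hv)
    _ ≤ 2 ^ n * B := by
        rw [Finset.sum_const, nsmul_eq_mul]
        gcongr
        have := Finset.card_le_univ (Finset.univ.filter (fun v : Vec n => Close γ v q))
        have h2 : Fintype.card (Vec n) = 2 ^ n := by simp [ZMod.card]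
        rw [h2] at this
        exact_mod_cast this

lemma prob_hit_le {n M : ℕ} {α β γ : ℝ} (L : List (Vec n)) (v q : Vec n) :
    prob {C : Fin M → Vec n | v ∈ query β γ C (preprocess α C L) q}
      ≤ M * (((wedge α β v q).card : ℝ) / 2 ^ n) :=
  (prob_mono fun _ hC => (mem_query.1 hC).2.2).trans (prob_exists_mem_le _)

/-! ### Wedge sizes at fixed length: monotonicity, lower bound, Chernoff bound. -/

lemma hammingDist_update_of_eq {n : ℕ} {x y : Vec n} {k : Fin n} (h : x k = y k) :
    hammingDist x (Function.update y k (y k + 1)) = hammingDist x y + 1 := by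
  unfold hammingDist
  have : (Finset.univ.filter fun i => x i ≠ Function.update y k (y k + 1) i) =
      Insert.insert k (Finset.univ.filter fun i => x i ≠ y i) := by
    ext i
    by_cases hi : i = k
    · subst hi; simp [h]
    · simp [hi]
  rw [this, Finset.card_insert_of_notMem (by simp [h])]

lemma zmod_two_add_one_add_one (a : ZMod 2) : a + 1 + 1 = a := by
  revert a; decide

lemma zmod_two_add_one_eq {a b : ZMod 2} (h : a ≠ b) : a + 1 = b := by
  revert a b; decide

lemma hammingDist_update_of_ne {n : ℕ} {x y : Vec n} {k : Fin n} (h : x k ≠ y k) :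
    hammingDist x (Function.update y k (y k + 1)) + 1 = hammingDist x y := by
  have h' : x k = Function.update y k (y k + 1) k := by
    rw [Function.update_self, zmod_two_add_one_eq h.symm]
  have := hammingDist_update_of_eq h'
  rw [← this]
  congr 1
  simp [zmod_two_add_one_add_one]

lemma hammingDist_update_update {n : ℕ} (x y : Vec n) (k : Fin n) :
    hammingDist (Function.update x k (x k + 1)) (Function.update y k (y k + 1)) =
      hammingDist x y := by
  unfold hammingDist
  congr 1
  ext i
  by_cases hi : i = k
  · subst hi; simp
  · simp [hi]

/-- Moving `q` away from `v` by flipping one coordinate does not enlarge the wedge. -/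
lemma card_wedge_update_le {n : ℕ} (α β : ℝ) {v q : Vec n} {k : Fin n} (h : v k = q k) :
    (wedge α β v (Function.update q k (q k + 1))).card ≤ (wedge α β v q).card := by
  classical
  set q' := Function.update q k (q k + 1) with hq'
  let F : Vec n → Vec n := fun c => Function.update c k (c k + 1)
  have hF : ∀ c, F (F c) = c := fun c => by
    simp [F, zmod_two_add_one_add_one]
  -- Such a `c` disagrees with `q`, hence with `v`, at `k`. Flipping that coordinate of `c` brings
  -- it closer to `v` and exchanges its distances to `q` and `q'`.
  have key : ∀ c ∈ wedge α β v q', c ∉ wedge α β v q →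
      F c ∈ wedge α β v q ∧ F c ∉ wedge α β v q' := by
    intro c hc hc'
    rw [mem_wedge] at hc hc'
    have h1 : ¬ Close β c q := fun h => hc' ⟨hc.1, h⟩
    have hck : c k ≠ q k := by
      intro hk
      apply h1
      have := hammingDist_update_of_eq hk
      have h2 := hc.2
      unfold Close at h2 ⊢
      rw [hq', this] at h2
      push_cast at h2
      linarith
    have e1 : hammingDist (F c) v + 1 = hammingDist c v := by
      rw [hammingDist_comm, hammingDist_comm c v]
      exact hammingDist_update_of_ne (by rw [h]; exact hck.symm)
    have e2 : hammingDist (F c) q' = hammingDist c q := hammingDist_update_update c q k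
    have e3 : hammingDist (F c) q = hammingDist c q' := by
      rw [← hammingDist_update_update c q' k]
      congr 1
      simp [hq', zmod_two_add_one_add_one]
    refine ⟨mem_wedge.2 ⟨?_, ?_⟩, fun hh => ?_⟩
    · have := hc.1
      unfold Close at this ⊢
      rw [← e1] at this
      push_cast at this
      linarith
    · unfold Close; rw [e3]; exact hc.2
    · have := (mem_wedge.1 hh).2
      unfold Close at this
      rw [e2] at this
      exact h1 this
  -- Common points stay fixed and the others are flipped. Flipped points leave the wedge of `q'`, so
  -- they cannot collide with fixed ones.
  refine Finset.card_le_card_of_injOn (fun c => if c ∈ wedge α β v q then c else F c) ?_ ?_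
  · intro c hc
    by_cases hcq : c ∈ wedge α β v q
    · simp [hcq]
    · simpa [hcq] using (key c hc hcq).1
  · intro c hc d hd hcd
    by_cases hcq : c ∈ wedge α β v q <;> by_cases hdq : d ∈ wedge α β v q
    · simpa [hcq, hdq] using hcd
    · simp only [hcq, hdq, if_true, if_false] at hcd
      exact absurd (hcd ▸ hc) (key d hd hdq).2
    · simp only [hcq, hdq, if_true, if_false] at hcd
      exact absurd (hcd ▸ hd) (key c hc hcq).2
    · simp only [hcq, hdq, if_false] at hcd
      rw [← hF c, hcd, hF]

lemma le_card_wedge_of_hammingDist_le {n : ℕ} {α β : ℝ} {v : Vec n} {T D : ℕ} (hD : D ≤ n)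
    (hT : ∀ q, hammingDist v q = D → T ≤ (wedge α β v q).card) (q : Vec n)
    (hq : hammingDist v q ≤ D) : T ≤ (wedge α β v q).card := by
  obtain ⟨m, hm⟩ := Nat.exists_eq_add_of_le hq
  induction m generalizing q with
  | zero => exact hT q (by omega)
  | succ m ih =>
    have : ∃ k, v k = q k := by
      by_contra! hne
      have : hammingDist v q = n := by
        simp [hammingDist, hne]
      omega
    obtain ⟨k, hk⟩ := this
    have e := hammingDist_update_of_eq hk
    exact (ih _ (by omega) (by omega)).trans (card_wedge_update_le α β hk)

/-- Flip `i` coordinates of `v` where it differs from `q` and `j` where it agrees: the former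
approach `q`, the latter move away from it, and all move away from `v`. -/
lemma choose_mul_choose_le_card_wedge {n : ℕ} {α β : ℝ} {v q : Vec n} {i j : ℕ}
    (h1 : ((i + j : ℕ) : ℝ) ≤ α * n)
    (h2 : ((hammingDist v q - i + j : ℕ) : ℝ) ≤ β * n) :
    (hammingDist v q).choose i * (n - hammingDist v q).choose j ≤ (wedge α β v q).card := by
  classical
  set S := Finset.univ.filter fun k => v k ≠ q k with hS
  have hSc : S.card = hammingDist v q := rfl
  have hSc' : Sᶜ.card = n - hammingDist v q := by rw [Finset.card_compl, hSc]; simp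
  rw [← hSc', ← hSc, ← Finset.card_powersetCard, ← Finset.card_powersetCard,
    ← Finset.card_product]
  refine Finset.card_le_card_of_injOn
    (fun P k => if k ∈ P.1 ∪ P.2 then v k + 1 else v k) ?_ ?_
  · rintro ⟨A, B⟩ hP
    simp only [Finset.coe_product, Set.mem_prod, Finset.mem_coe, Finset.mem_powersetCard] at hP
    obtain ⟨⟨hA, hAi⟩, hB, hBj⟩ := hP
    have hAB : Disjoint A B := Finset.disjoint_of_subset_left hA
      (Finset.disjoint_of_subset_right hB disjoint_compl_right)
    have hAB' : Disjoint (S \ A) B := Finset.disjoint_of_subset_left Finset.sdiff_subset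
      (Finset.disjoint_of_subset_right hB disjoint_compl_right)
    have e1 : hammingDist (fun k => if k ∈ A ∪ B then v k + 1 else v k) v = i + j := by
      rw [← hAi, ← hBj, ← Finset.card_union_of_disjoint hAB]
      unfold hammingDist
      congr 1
      ext k
      simp only [Finset.mem_filter, Finset.mem_univ, true_and]
      by_cases hk : k ∈ A ∪ B
      · simp only [hk, if_true]; simp
      · simp only [hk, if_false]; simp
    have e2 : hammingDist (fun k => if k ∈ A ∪ B then v k + 1 else v k) q =
        hammingDist v q - i + j := by
      rw [← hAi, ← hBj, ← hSc, ← Finset.card_sdiff_of_subset hA,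
        ← Finset.card_union_of_disjoint hAB']
      unfold hammingDist
      congr 1
      ext k
      simp only [Finset.mem_filter, Finset.mem_univ, true_and, Finset.mem_union, Finset.mem_sdiff]
      by_cases hkA : k ∈ A
      · have hkS : v k ≠ q k := by simpa [hS] using hA hkA
        have hkB : k ∉ B := Finset.disjoint_left.1 hAB hkA
        simp [hkA, hkB, zmod_two_add_one_eq hkS]
      · by_cases hkB : k ∈ B
        · have hkS : v k = q k := by simpa [hS] using hB hkB
          simp [hkB, hkS]
        · simp [hkA, hkB, hS]
    simp only [Finset.mem_coe, mem_wedge, Close, e1, e2]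
    exact ⟨h1, h2⟩
  · rintro ⟨A, B⟩ hP ⟨A', B'⟩ hP' h
    simp only [Finset.coe_product, Set.mem_prod, Finset.mem_coe, Finset.mem_powersetCard] at hP hP'
    have hU : ∀ k, k ∈ A ∪ B ↔ k ∈ A' ∪ B' := by
      intro k
      have := congrFun h k
      by_cases h1 : k ∈ A ∪ B <;> by_cases h2 : k ∈ A' ∪ B' <;> simp_all
    have hin : ∀ {A B : Finset (Fin n)}, A ⊆ S → B ⊆ Sᶜ → (A ∪ B) ∩ S = A ∧ (A ∪ B) \ S = B := by
      intro A B hA hB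
      constructor
      · ext k
        have := @hA k
        have := @hB k
        simp only [Finset.mem_compl] at this
        simp only [Finset.mem_inter, Finset.mem_union]
        tauto
      · ext k
        have := @hA k
        have := @hB k
        simp only [Finset.mem_compl] at this
        simp only [Finset.mem_sdiff, Finset.mem_union]
        tauto
    have hU' : A ∪ B = A' ∪ B' := Finset.ext hU
    have a1 := hin hP.1.1 hP.2.1
    have a2 := hin hP'.1.1 hP'.2.1
    rw [Prod.mk.injEq]
    exact ⟨by rw [← a1.1, ← a2.1, hU'], by rw [← a1.2, ← a2.2, hU']⟩

/-- Chernoff bound for the size of a wedge. -/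
lemma card_wedge_le {n : ℕ} {α β s t : ℝ} (hs : 0 < s) (hs1 : s ≤ 1) (ht : 0 < t) (ht1 : t ≤ 1)
    (v q : Vec n) :
    ((wedge α β v q).card : ℝ) ≤ s ^ (-(α * n)) * t ^ (-(β * n)) *
      ((s + t) ^ hammingDist v q * (1 + s * t) ^ (n - hammingDist v q)) := by
  classical
  -- The generating function factors over coordinates: `s + t` where `v` and `q` differ, `1 + s * t`
  -- where they agree.
  have hsum : ∑ c : Vec n, s ^ hammingDist c v * t ^ hammingDist c q =
      (s + t) ^ hammingDist v q * (1 + s * t) ^ (n - hammingDist v q) := by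
    have hpow : ∀ (r : ℝ) (x y : Vec n), r ^ hammingDist x y = ∏ k, if x k ≠ y k then r else 1 := by
      intro r x y
      rw [Finset.prod_ite]
      simp [hammingDist]
    simp_rw [hpow s _ v, hpow t _ q, ← Finset.prod_mul_distrib]
    have := Finset.prod_univ_sum (fun _ : Fin n => (Finset.univ : Finset (ZMod 2)))
      (fun k (b : ZMod 2) => (if b ≠ v k then s else 1) * (if b ≠ q k then t else 1))
    rw [Fintype.piFinset_univ] at this
    rw [← this]
    have hk : ∀ a b : ZMod 2, ∑ x : ZMod 2, (if x ≠ a then s else 1) * (if x ≠ b then t else 1) =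
        if a ≠ b then s + t else 1 + s * t := by
      intro a b
      have hF : ∀ f : ZMod 2 → ℝ, ∑ x, f x = f 0 + f 1 := fun f => Fin.sum_univ_two f
      rw [hF]
      have h01 : ∀ a : ZMod 2, a = 0 ∨ a = 1 := by decide
      rcases h01 a with rfl | rfl <;> rcases h01 b with rfl | rfl <;> simp <;> ring
    simp_rw [hk]
    rw [Finset.prod_ite, Finset.prod_const, Finset.prod_const]
    congr 2
    rw [Finset.filter_not, ← Finset.compl_eq_univ_sdiff, Finset.card_compl]
    simp only [Fintype.card_fin]
    rfl
  have h1 : ∀ c ∈ wedge α β v q, (1 : ℝ) ≤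
      s ^ (-(α * n)) * t ^ (-(β * n)) * (s ^ hammingDist c v * t ^ hammingDist c q) := by
    intro c hc
    obtain ⟨ha, hb⟩ := mem_wedge.1 hc
    have hh : ∀ {r δ : ℝ} {x y : Vec n}, 0 < r → r ≤ 1 → Close δ x y →
        1 ≤ r ^ (-(δ * n)) * r ^ hammingDist x y := by
      intro r δ x y hr hr1 hxy
      rw [← Real.rpow_natCast r (hammingDist x y), ← Real.rpow_add hr]
      apply Real.one_le_rpow_of_pos_of_le_one_of_nonpos hr hr1
      unfold Close at hxy
      linarith
    calc (1 : ℝ) ≤ (s ^ (-(α * n)) * s ^ hammingDist c v) * (t ^ (-(β * n)) * t ^ hammingDist c q) :=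
          one_le_mul_of_one_le_of_one_le (hh hs hs1 ha) (hh ht ht1 hb)
      _ = _ := by ring
  calc ((wedge α β v q).card : ℝ) = ∑ c ∈ wedge α β v q, (1 : ℝ) := by simp
    _ ≤ ∑ c ∈ wedge α β v q,
        s ^ (-(α * n)) * t ^ (-(β * n)) * (s ^ hammingDist c v * t ^ hammingDist c q) :=
        Finset.sum_le_sum h1
    _ ≤ ∑ c : Vec n,
        s ^ (-(α * n)) * t ^ (-(β * n)) * (s ^ hammingDist c v * t ^ hammingDist c q) :=
        Finset.sum_le_sum_of_subset_of_nonneg (Finset.subset_univ _)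
          fun c _ _ => by positivity
    _ = _ := by rw [← Finset.mul_sum, hsum]

end LSF

/-! ### Stirling estimates and growth rates of binomial coefficients. -/

/-- Induction, comparing increments through `1 / (x + 1) ≤ log (x + 1) - log x ≤ 1 / x`. A
logarithmic error suffices, since it is later divided by `n`. -/
lemma abs_log_factorial_sub_le (m : ℕ) :
    |Real.log (m.factorial) - (m * Real.log m - m)| ≤ 1 + Real.log (m + 1) := by
  have key : ∀ m : ℕ, 0 ≤ Real.log ((m + 1).factorial) -
        ((m + 1 : ℕ) * Real.log ((m + 1 : ℕ)) - (m + 1 : ℕ)) ∧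
      Real.log ((m + 1).factorial) - ((m + 1 : ℕ) * Real.log ((m + 1 : ℕ)) - (m + 1 : ℕ)) ≤
        1 + Real.log ((m + 1 : ℕ)) := by
    intro m
    induction m with
    | zero => simp
    | succ m ih =>
      have hf : Real.log ((m + 1 + 1).factorial) =
          Real.log ((m + 1 + 1 : ℕ)) + Real.log ((m + 1).factorial) := by
        rw [Nat.factorial_succ (m + 1), Nat.cast_mul, Real.log_mul (by positivity) (by positivity)]
      rw [hf]
      have hx : (0 : ℝ) < (m + 1 : ℕ) := by positivity
      have hc : ((m + 1 + 1 : ℕ) : ℝ) = ((m + 1 : ℕ) : ℝ) + 1 := by push_cast; ring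
      rw [hc]
      generalize ((m + 1 : ℕ) : ℝ) = x at *
      have h1 : Real.log (x + 1) - Real.log x ≤ 1 / x := by
        rw [← Real.log_div (by positivity) (by positivity)]
        have := Real.log_le_sub_one_of_pos (show 0 < (x + 1) / x by positivity)
        refine this.trans (le_of_eq ?_)
        field_simp; ring
      have h2 : 1 / (x + 1) ≤ Real.log (x + 1) - Real.log x := by
        rw [← Real.log_div (by positivity) (by positivity)]
        have := Real.one_sub_inv_le_log_of_pos (show 0 < (x + 1) / x by positivity)
        refine (le_of_eq ?_).trans this
        field_simp; ring
      rw [le_div_iff₀ hx] at h1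
      rw [div_le_iff₀ (by positivity)] at h2
      constructor <;> nlinarith [ih.1, ih.2]
  rcases m with _ | m
  · simp
  · have := key m
    rw [abs_of_nonneg this.1]
    refine this.2.trans ?_
    gcongr
    linarith

lemma tendsto_log_div_nat : Tendsto (fun n : ℕ => Real.log n / n) atTop (𝓝 0) := by
  have := Real.isLittleO_log_id_atTop.tendsto_div_nhds_zero
  exact this.comp tendsto_natCast_atTop_atTop

/-- The subtracted term is linear in `m n`, so it cancels in a binomial coefficient. Continuity of
`negMulLog` at `0` admits `μ = 0`. -/
lemma tendsto_log_factorial_div {m : ℕ → ℕ} {μ : ℝ} (hm : ∀ n, m n ≤ n)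
    (h : Tendsto (fun n : ℕ => (m n : ℝ) / n) atTop (𝓝 μ)) :
    Tendsto (fun n : ℕ => Real.log ((m n).factorial) / n - (m n / n : ℝ) * (Real.log n - 1))
      atTop (𝓝 (-Real.negMulLog μ)) := by
  have h1 : Tendsto (fun n : ℕ => -Real.negMulLog ((m n : ℝ) / n)) atTop
      (𝓝 (-Real.negMulLog μ)) :=
    ((Real.continuous_negMulLog.tendsto μ).comp h).neg
  have h2 : Tendsto (fun n : ℕ =>
      (Real.log ((m n).factorial) - (m n * Real.log (m n) - m n)) / n) atTop (𝓝 0) := by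
    have hb : Tendsto (fun n : ℕ => 1 / (n : ℝ) + (Real.log 2 / n + Real.log n / n)) atTop (𝓝 0) := by
      have := (tendsto_one_div_atTop_nhds_zero_nat (𝕜 := ℝ)).add
        ((tendsto_const_div_atTop_nhds_zero_nat (Real.log 2)).add tendsto_log_div_nat)
      simpa using this
    refine squeeze_zero_norm' ?_ hb
    filter_upwards [eventually_ge_atTop 1] with n hn
    have hn0 : (1 : ℝ) ≤ n := by exact_mod_cast hn
    rw [norm_div, Real.norm_eq_abs, Real.norm_eq_abs, abs_of_nonneg (by linarith : (0 : ℝ) ≤ n),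
      ← add_div, ← add_div]
    gcongr
    refine (abs_log_factorial_sub_le _).trans ?_
    rw [← Real.log_mul (by norm_num) (by positivity)]
    gcongr
    have : (m n : ℝ) ≤ n := by exact_mod_cast hm n
    linarith
  have := h1.add h2
  rw [add_zero] at this
  refine this.congr' ?_
  filter_upwards [eventually_ge_atTop 1] with n hn
  have hn0 : (0 : ℝ) < n := by exact_mod_cast hn
  unfold Real.negMulLog
  rcases Nat.eq_zero_or_pos (m n) with h0 | h0
  · simp [h0]
  · have : (0 : ℝ) < m n := by exact_mod_cast h0
    rw [Real.log_div this.ne' hn0.ne']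
    field_simp
    ring

/-- Exponential growth rate of binomial coefficients. -/
lemma tendsto_log_choose_div {m k : ℕ → ℕ} {μ κ : ℝ} (hm : ∀ n, m n ≤ n) (hk : ∀ n, k n ≤ m n)
    (hmu : Tendsto (fun n : ℕ => (m n : ℝ) / n) atTop (𝓝 μ))
    (hka : Tendsto (fun n : ℕ => (k n : ℝ) / n) atTop (𝓝 κ)) :
    Tendsto (fun n : ℕ => Real.log ((m n).choose (k n)) / n) atTop
      (𝓝 (Real.negMulLog κ + Real.negMulLog (μ - κ) - Real.negMulLog μ)) := by
  have h3 : Tendsto (fun n : ℕ => ((m n - k n : ℕ) : ℝ) / n) atTop (𝓝 (μ - κ)) := by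
    refine (hmu.sub hka).congr fun n => ?_
    rw [Nat.cast_sub (hk n), sub_div]
  have := ((tendsto_log_factorial_div hm hmu).sub
    (tendsto_log_factorial_div (fun n => (hk n).trans (hm n)) hka)).sub
    (tendsto_log_factorial_div (fun n => (Nat.sub_le _ _).trans (hm n)) h3)
  refine (this.congr fun n => ?_).trans (le_of_eq (by congr 1; ring))
  rw [Nat.choose_eq_factorial_div_factorial (hk n),
    Nat.cast_div (Nat.factorial_mul_factorial_dvd_factorial (hk n)) (by positivity), Nat.cast_mul,
    Real.log_div (by positivity) (by positivity), Real.log_mul (by positivity) (by positivity),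
    Nat.cast_sub (hk n)]
  ring

lemma tendsto_natFloor_mul_div {a : ℝ} (ha : 0 ≤ a) :
    Tendsto (fun n : ℕ => (⌊a * n⌋₊ : ℝ) / n) atTop (𝓝 a) :=
  (tendsto_nat_floor_mul_div_atTop ha).comp tendsto_natCast_atTop_atTop

lemma tendsto_natFloor_mul_sub_one_div {a : ℝ} (ha : 0 ≤ a) :
    Tendsto (fun n : ℕ => ((⌊a * n⌋₊ - 1 : ℕ) : ℝ) / n) atTop (𝓝 a) := by
  have h1 := tendsto_natFloor_mul_div ha
  have h2 := h1.sub (tendsto_one_div_atTop_nhds_zero_nat (𝕜 := ℝ))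
  rw [sub_zero] at h2
  refine tendsto_of_tendsto_of_tendsto_of_le_of_le h2 h1 (fun n => ?_) (fun n => ?_)
  · simp only [← sub_div]
    gcongr
    have : ⌊a * n⌋₊ ≤ (⌊a * n⌋₊ - 1) + 1 := by omega
    have : (⌊a * n⌋₊ : ℝ) ≤ ((⌊a * n⌋₊ - 1 : ℕ) : ℝ) + 1 := by exact_mod_cast this
    linarith
  · simp only
    gcongr
    omega

/-! ### The filter exponent in terms of the wedge rate. -/

lemma logb_two_half_negMulLog (x : ℝ) :
    x / 2 * Real.logb 2 (x / 2) = -(Real.negMulLog x / Real.log 2) / 2 - x / 2 := by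
  rcases eq_or_ne x 0 with rfl | hx
  · simp
  · have : Real.log 2 ≠ 0 := (Real.log_pos (by norm_num)).ne'
    rw [Real.logb, Real.log_div hx (by norm_num), Real.negMulLog]
    field_simp

/-- The exponential rate of the size of a wedge, in nats. -/
noncomputable def wedgeRate (α β γ : ℝ) : ℝ :=
  (Real.negMulLog ((γ + α - β) / 2) + Real.negMulLog (γ - (γ + α - β) / 2) - Real.negMulLog γ) +
  (Real.negMulLog ((α + β - γ) / 2) + Real.negMulLog (1 - γ - (α + β - γ) / 2) -
    Real.negMulLog (1 - γ))

/-- The weights occur in equal pairs, so each of the two entropies contains one extra bit, and these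
cancel in the difference. -/
lemma filterExponent_eq (α β γ : ℝ) :
    filterExponent α β γ = 1 - wedgeRate α β γ / Real.log 2 := by
  have h1 : entropy (balancedTriple α β γ) =
      (Real.negMulLog ((γ + α - β) / 2) + Real.negMulLog (γ - (γ + α - β) / 2) +
      (Real.negMulLog ((α + β - γ) / 2) + Real.negMulLog (1 - γ - (α + β - γ) / 2))) / Real.log 2
      + 1 := by
    have e1 : 1 / 2 - (γ + β + α) / 4 = (1 - γ - (α + β - γ) / 2) / 2 := by ring
    have e2 : (γ + β - α) / 4 = (γ - (γ + α - β) / 2) / 2 := by ring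
    have e3 : (γ + α - β) / 4 = ((γ + α - β) / 2) / 2 := by ring
    have e4 : (β + α - γ) / 4 = ((α + β - γ) / 2) / 2 := by ring
    simp only [entropy, Fintype.sum_prod_type, Fin.sum_univ_two, balancedTriple]
    rw [e1, e2, e3, e4]
    simp only [logb_two_half_negMulLog]
    ring
  have h2 : entropy (balancedPair γ) =
      (Real.negMulLog γ + Real.negMulLog (1 - γ)) / Real.log 2 + 1 := by
    simp only [entropy, Fintype.sum_prod_type, Fin.sum_univ_two, balancedPair]
    simp only [logb_two_half_negMulLog]
    ring
  rw [filterExponent, h1, h2, wedgeRate]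
  ring

lemma isProbVector_balancedTriple {α β γ : ℝ} (hα : α ≤ 1 / 2) (hβ : β ≤ 1 / 2)
    (hlow : |α - β| ≤ γ) (hupp : γ < α + β) : IsProbVector (balancedTriple α β γ) := by
  rw [abs_le] at hlow
  constructor
  · rintro ⟨i, j, k⟩
    fin_cases i <;> fin_cases j <;> fin_cases k <;> constructor <;>
      simp only [balancedTriple] <;> linarith
  · simp only [Fintype.sum_prod_type, Fin.sum_univ_two, balancedTriple]
    ring

lemma isProbVector_balancedPair {γ : ℝ} (hγ : 0 ≤ γ ∧ γ ≤ 1 / 2) :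
    IsProbVector (balancedPair γ) := by
  constructor
  · rintro ⟨i, j⟩
    fin_cases i <;> fin_cases j <;> constructor <;>
      simp only [balancedPair] <;> linarith
  · simp only [Fintype.sum_prod_type, Fin.sum_univ_two, balancedPair]
    ring

/-! ### Sufficiency: asymptotic lower bound for wedges and the number of filters. -/

namespace LSF

lemma exists_le_card_wedge (α β γ : ℝ)
    (hα : α ≤ 1 / 2) (hβ : β ≤ 1 / 2) (hγ : 0 ≤ γ ∧ γ ≤ 1 / 2)
    (hlow : |α - β| ≤ γ) (hupp : γ < α + β) :
    ∃ T : ℕ → ℕ, (∀ n, 0 < T n) ∧ (∀ n, T n ≤ 2 ^ n) ∧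
      Tendsto (fun n : ℕ => Real.log (T n) / n) atTop (𝓝 (wedgeRate α β γ)) ∧
      ∀ᶠ n : ℕ in atTop, ∀ v q : Vec n, Close γ v q → T n ≤ (wedge α β v q).card := by
  rw [abs_le] at hlow
  -- The proportions of flips solve `a + b = α` and `γ - a + b = β`, so both distance constraints
  -- are tight.
  set a := (γ + α - β) / 2 with ha
  set b := (α + β - γ) / 2 with hb
  have ha0 : 0 ≤ a := by linarith
  have haγ : a ≤ γ := by linarith
  have hb0 : 0 < b := by linarith
  have hbγ : γ + b ≤ 1 := by linarith
  set D : ℕ → ℕ := fun n => ⌊γ * n⌋₊ with hD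
  set i : ℕ → ℕ := fun n => ⌊a * n⌋₊ with hi
  -- Rounding `a * n` down can raise the distance to `q` by almost `1`; one flip fewer outside the
  -- difference set compensates.
  set j : ℕ → ℕ := fun n => ⌊b * n⌋₊ - 1 with hj
  have fl : ∀ {x : ℝ} (n : ℕ), 0 ≤ x → (⌊x * n⌋₊ : ℝ) ≤ x * n := fun n hx =>
    Nat.floor_le (by positivity)
  have hDn : ∀ n, D n ≤ n := fun n => by
    have := fl n hγ.1
    have h2 : γ * n ≤ 1 * n := by gcongr; linarith
    exact_mod_cast (show ((D n : ℕ) : ℝ) ≤ n by linarith)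
  have hiD : ∀ n, i n ≤ D n := fun n => Nat.floor_le_floor (by gcongr)
  have hjD : ∀ n, j n ≤ n - D n := fun n => by
    have h1 := fl n hγ.1
    have h2 := fl n hb0.le
    have h3 : (γ + b) * n ≤ 1 * n := by gcongr
    have : D n + ⌊b * n⌋₊ ≤ n := by
      exact_mod_cast (show ((D n : ℕ) : ℝ) + (⌊b * n⌋₊ : ℕ) ≤ n by linarith)
    simp only [hj]
    omega
  refine ⟨fun n => (D n).choose (i n) * (n - D n).choose (j n), fun n => ?_, fun n => ?_, ?_, ?_⟩
  · exact Nat.mul_pos (Nat.choose_pos (hiD n)) (Nat.choose_pos (hjD n))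
  · calc _ ≤ 2 ^ D n * 2 ^ (n - D n) :=
        Nat.mul_le_mul (Nat.choose_le_two_pow _ _) (Nat.choose_le_two_pow _ _)
      _ = 2 ^ n := by rw [← pow_add, Nat.add_sub_cancel' (hDn n)]
  · have hDt : Tendsto (fun n : ℕ => (D n : ℝ) / n) atTop (𝓝 γ) := tendsto_natFloor_mul_div hγ.1
    have hDt' : Tendsto (fun n : ℕ => ((n - D n : ℕ) : ℝ) / n) atTop (𝓝 (1 - γ)) := by
      refine (hDt.const_sub 1).congr' ?_
      filter_upwards [eventually_ge_atTop 1] with n hn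
      have : (n : ℝ) ≠ 0 := by positivity
      rw [Nat.cast_sub (hDn n), sub_div, div_self this]
    have h1 := tendsto_log_choose_div hDn hiD hDt (tendsto_natFloor_mul_div ha0)
    have h2 := tendsto_log_choose_div (fun n => Nat.sub_le n (D n)) hjD hDt'
      (tendsto_natFloor_mul_sub_one_div hb0.le)
    refine (h1.add h2).congr fun n => ?_
    have p1 := Nat.choose_pos (hiD n)
    have p2 := Nat.choose_pos (hjD n)
    rw [← add_div, Nat.cast_mul, Real.log_mul (by positivity) (by positivity)]
  · have hlarge : ∀ᶠ n : ℕ in atTop, 1 ≤ b * n :=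
      (tendsto_natCast_atTop_atTop.const_mul_atTop hb0).eventually_ge_atTop 1
    filter_upwards [hlarge] with n hn v q hvq
    refine le_card_wedge_of_hammingDist_le (hDn n) (fun q' hq' => ?_) q (Nat.le_floor hvq)
    have hj1 : j n + 1 = ⌊b * n⌋₊ := Nat.sub_add_cancel (Nat.le_floor (by exact_mod_cast hn))
    have hj2 : (j n : ℝ) + 1 ≤ b * n := by
      have := fl n hb0.le
      rw [← hj1] at this
      exact_mod_cast this
    have hi2 : (i n : ℝ) ≤ a * n := fl n ha0
    have hi3 : a * n < i n + 1 := Nat.lt_floor_add_one _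
    have hD2 : (D n : ℝ) ≤ γ * n := fl n hγ.1
    rw [← hq']
    apply choose_mul_choose_le_card_wedge
    · push_cast
      have : α * n = a * n + b * n := by rw [ha, hb]; ring
      linarith
    · rw [hq', Nat.cast_add, Nat.cast_sub (hiD n)]
      have : β * n = γ * n - a * n + b * n := by rw [ha, hb]; ring
      linarith

lemma one_sub_pow_le_exp_neg {x : ℝ} (hx : x ≤ 1) (M : ℕ) : (1 - x) ^ M ≤ Real.exp (-(M * x)) := by
  calc (1 - x) ^ M ≤ Real.exp (-x) ^ M := by
        exact pow_le_pow_left₀ (by linarith) (Real.one_sub_le_exp_neg x) M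
    _ = _ := by rw [← Real.exp_nat_mul]; ring_nf

/-- The number of filter vectors used for sufficiency, given a lower bound `T` for the wedges. -/
noncomputable def numFilters (T : ℕ → ℕ) (n : ℕ) : ℕ := ⌈(n : ℝ) ^ 2 * 2 ^ n / T n⌉₊

lemma tendsto_logb_numFilters {T : ℕ → ℕ} {h : ℝ} (hT0 : ∀ n, 0 < T n) (hT : ∀ n, T n ≤ 2 ^ n)
    (hTh : Tendsto (fun n : ℕ => Real.log (T n) / n) atTop (𝓝 h)) :
    Tendsto (fun n : ℕ => Real.logb 2 (numFilters T n) / n) atTop (𝓝 (1 - h / Real.log 2)) := by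
  have hl2 : 0 < Real.log 2 := Real.log_pos (by norm_num)
  have hlim : Tendsto (fun n : ℕ => 2 * (Real.log n / n) + Real.log 2 - Real.log (T n) / n) atTop
      (𝓝 (Real.log 2 - h)) := by
    have := ((tendsto_log_div_nat.const_mul 2).add_const (Real.log 2)).sub hTh
    simpa using this
  have hlim2 : Tendsto (fun n : ℕ => Real.log 2 / n +
      (2 * (Real.log n / n) + Real.log 2 - Real.log (T n) / n)) atTop (𝓝 (Real.log 2 - h)) := by
    have := (tendsto_const_div_atTop_nhds_zero_nat (Real.log 2)).add hlim
    simpa using this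
  have hx : ∀ n : ℕ, 1 ≤ n → Real.log ((n : ℝ) ^ 2 * 2 ^ n / T n) =
      (2 * (Real.log n / n) + Real.log 2 - Real.log (T n) / n) * n := by
    intro n hn
    have := hT0 n
    have hn' : (n : ℝ) ≠ 0 := by positivity
    rw [Real.log_div (by positivity) (by positivity), Real.log_mul (by positivity) (by positivity),
      Real.log_pow, Real.log_pow]
    field_simp
    push_cast
    ring
  -- Being at least `1`, the quantity is at most doubled by the ceiling, which costs only `log 2 /
  -- n`.
  have hx1 : ∀ n : ℕ, 1 ≤ n → 1 ≤ (n : ℝ) ^ 2 * 2 ^ n / T n := by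
    intro n hn
    have h0 : (0 : ℝ) < T n := by exact_mod_cast hT0 n
    have h1 : (T n : ℝ) ≤ 2 ^ n := by exact_mod_cast hT n
    have h2 : (1 : ℝ) ≤ (n : ℝ) ^ 2 := one_le_pow₀ (by exact_mod_cast hn)
    rw [le_div_iff₀ h0, one_mul]
    nlinarith
  have hM : Tendsto (fun n : ℕ => Real.log (numFilters T n) / n) atTop (𝓝 (Real.log 2 - h)) := by
    refine tendsto_of_tendsto_of_tendsto_of_le_of_le' hlim hlim2 ?_ ?_
    · filter_upwards [eventually_ge_atTop 1] with n hn
      have hn0 : (0 : ℝ) < n := by exact_mod_cast hn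
      rw [le_div_iff₀ hn0, ← hx n hn]
      have := hx1 n hn
      gcongr
      exact Nat.le_ceil _
    · filter_upwards [eventually_ge_atTop 1] with n hn
      have hn0 : (0 : ℝ) < n := by exact_mod_cast hn
      have := hx1 n hn
      have hc := Nat.le_ceil ((n : ℝ) ^ 2 * 2 ^ n / T n)
      have hc2 := (Nat.ceil_lt_add_one (by linarith : 0 ≤ (n : ℝ) ^ 2 * 2 ^ n / T n)).le
      rw [div_le_iff₀ hn0, add_mul, ← hx n hn, div_mul_cancel₀ _ hn0.ne',
        ← Real.log_mul (by norm_num) (by linarith)]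
      apply Real.log_le_log
      · unfold numFilters; linarith
      · unfold numFilters; linarith
  have := hM.div_const (Real.log 2)
  rw [sub_div, div_self hl2.ne'] at this
  refine this.congr fun n => ?_
  rw [Real.logb, div_right_comm]

/-- The factor `n ^ 2` makes the expected number of filter vectors in each relevant wedge at least
`n ^ 2`. It is invisible in the exponent, yet `exp (-n ^ 2)` beats the union bound. -/
lemma prob_miss_numFilters_le {α β γ : ℝ} {T : ℕ → ℕ} {n : ℕ} (hT0 : 0 < T n)
    (hT : ∀ v q : Vec n, Close γ v q → T n ≤ (wedge α β v q).card) (L : List (Vec n)) (q : Vec n) :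
    prob {C : Fin (numFilters T n) → Vec n |
        ¬ ∀ v ∈ L, Close γ v q → v ∈ query β γ C (preprocess α C L) q}
      ≤ 2 ^ n * Real.exp (-(n : ℝ) ^ 2) := by
  refine prob_miss_le L q (fun v hv => ?_) (Real.exp_pos _).le
  have hN : ((wedge α β v q).card : ℝ) / 2 ^ n ≤ 1 := by
    rw [div_le_one (by positivity)]
    have : (wedge α β v q).card ≤ 2 ^ n := by
      simpa [ZMod.card] using Finset.card_le_univ (wedge α β v q)
    exact_mod_cast this
  refine (one_sub_pow_le_exp_neg hN _).trans (Real.exp_le_exp.2 (neg_le_neg ?_))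
  have hT1 : (T n : ℝ) ≤ (wedge α β v q).card := by exact_mod_cast hT v q hv
  have hT2 : (0 : ℝ) < T n := by exact_mod_cast hT0
  calc (n : ℝ) ^ 2 = (n : ℝ) ^ 2 * 2 ^ n / T n * (T n / 2 ^ n) := by field_simp
    _ ≤ (numFilters T n : ℝ) * (((wedge α β v q).card : ℝ) / 2 ^ n) := by
      gcongr
      exact Nat.le_ceil _

lemma eventually_two_pow_mul_exp_neg_sq_le (K : ℝ) :
    ∀ᶠ n : ℕ in atTop, (2 : ℝ) ^ n * Real.exp (-(n : ℝ) ^ 2) ≤ (2 : ℝ) ^ (-(K * n)) := by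
  filter_upwards [tendsto_natCast_atTop_atTop.eventually_ge_atTop (Real.log 2 * (1 + K))] with n hn
  rw [← Real.rpow_natCast 2 n, Real.rpow_def_of_pos (by norm_num), Real.rpow_def_of_pos (by norm_num),
    ← Real.exp_add, Real.exp_le_exp]
  have : (0 : ℝ) ≤ n := by positivity
  nlinarith

/-! ### Necessity: optimal Chernoff parameters and the upper bound for wedges. -/

/-- The odds `x / (m - x)` are the stationary point of `z ↦ -x * log z + m * log (1 + z)`; the value
there is the binomial rate. -/
lemma tilt_eq {x m : ℝ} (hx : 0 < x) (hxm : x < m) :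
    -x * Real.log (x / (m - x)) + m * Real.log (1 + x / (m - x)) =
      Real.negMulLog x + Real.negMulLog (m - x) - Real.negMulLog m := by
  have h : 0 < m - x := by linarith
  have e : 1 + x / (m - x) = m / (m - x) := by field_simp; ring
  rw [e, Real.log_div hx.ne' h.ne', Real.log_div (by linarith) h.ne']
  unfold Real.negMulLog
  ring

/-- Parameters for which the Chernoff bound attains the rate. -/
lemma exists_chernoff_parameters {α β γ : ℝ}
    (hα : 0 ≤ α ∧ α ≤ 1 / 2) (hβ : 0 ≤ β ∧ β ≤ 1 / 2) (hγ : 0 ≤ γ ∧ γ ≤ 1 / 2)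
    (hlow : |α - β| ≤ γ) (hupp : γ < α + β) (h : |α - β| ≤ γ * (1 - 2 * min α β)) :
    ∃ s t : ℝ, 0 < s ∧ s ≤ 1 ∧ 0 < t ∧ t ≤ 1 ∧
      -α * Real.log s - β * Real.log t + (γ * Real.log (s + t) + (1 - γ) * Real.log (1 + s * t)) =
        wedgeRate α β γ := by
  obtain ⟨a, ha⟩ : ∃ a, a = (γ + α - β) / 2 := ⟨_, rfl⟩
  obtain ⟨b, hb⟩ : ∃ b, b = (α + β - γ) / 2 := ⟨_, rfl⟩
  have hb0 : 0 < b := by linarith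
  have hb1 : 0 < 1 - γ - b := by linarith
  set B := b / (1 - γ - b) with hB
  have hB0 : 0 < B := by positivity
  obtain ⟨A, hA0, hAB, hBA, hA⟩ : ∃ A : ℝ, 0 < A ∧ A * B ≤ 1 ∧ B ≤ A ∧
      -a * Real.log A + γ * Real.log (1 + A) =
        Real.negMulLog a + Real.negMulLog (γ - a) - Real.negMulLog γ := by
    -- For `γ = 0` the odds `a / (γ - a)` degenerate to `0 / 0`; since `a = 0`, any `A` gives the
    -- right value, and `A = 1` meets the constraints.
    rcases hγ.1.eq_or_lt with h0 | h0
    · subst h0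
      have hαβ : α = β := by
        have := abs_nonpos_iff.1 hlow
        linarith
      have hB1 : B ≤ 1 := by
        rw [hB, div_le_one hb1]
        linarith
      have ha' : a = 0 := by rw [ha, hαβ]; ring
      exact ⟨1, one_pos, by linarith, hB1, by simp [ha']⟩
    -- The last two inequalities are `A * B ≤ 1` and `B ≤ A` with denominators cleared. The extra
    -- hypothesis is the former if `β ≤ α` and the latter if `α ≤ β`.
    · have key : 0 < a ∧ a < γ ∧ a * (1 - γ) + γ * b ≤ γ * (1 - γ) ∧ b * γ ≤ a * (1 - γ) := by
        rw [abs_le] at hlow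
        rcases le_total β α with hle | hle
        · rw [abs_of_nonneg (by linarith), min_eq_right hle] at h
          have hβ0 : 0 < β := by
            rcases hβ.1.eq_or_lt with h1 | h1
            · linarith
            · exact h1
          have := mul_pos h0 hβ0
          refine ⟨by linarith, by nlinarith, ?_, ?_⟩
          · rw [ha, hb]; nlinarith
          · have h1 : γ / 2 ≤ a := by linarith
            have h2 : b ≤ (1 - γ) / 2 := by linarith
            nlinarith
        · rw [abs_of_nonpos (by linarith), min_eq_left hle] at h
          have hα0 : 0 < α := by
            rcases hα.1.eq_or_lt with h1 | h1
            · linarith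
            · exact h1
          have := mul_pos h0 hα0
          refine ⟨by nlinarith, by linarith, ?_, ?_⟩
          · have h1 : a ≤ γ / 2 := by linarith
            have h2 : b ≤ (1 - γ) / 2 := by linarith
            nlinarith
          · rw [ha, hb]; nlinarith
      obtain ⟨k1, k2, k3, k4⟩ := key
      have k5 : 0 < γ - a := by linarith
      refine ⟨a / (γ - a), by positivity, ?_, ?_, tilt_eq k1 k2⟩
      · rw [hB, div_mul_div_comm, div_le_one (by positivity)]
        nlinarith
      · rw [hB, div_le_div_iff₀ hb1 k5]
        nlinarith
  have hBeq := tilt_eq hb0 (show b < 1 - γ by linarith)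
  rw [← hB] at hBeq
  -- With `s * t = B` and `s / t = A`, one has `s + t = t * (1 + A)`, and the exponent splits into
  -- two one-variable problems.
  have hst : Real.sqrt (A * B) * Real.sqrt (B / A) = B := by
    rw [← Real.sqrt_mul (by positivity), show A * B * (B / A) = B * B by field_simp,
      Real.sqrt_mul_self hB0.le]
  have hsA : Real.sqrt (A * B) = A * Real.sqrt (B / A) := by
    rw [show A * B = A * A * (B / A) by field_simp, Real.sqrt_mul (by positivity),
      Real.sqrt_mul_self hA0.le]
  have ht0 : 0 < Real.sqrt (B / A) := by positivity
  refine ⟨Real.sqrt (A * B), Real.sqrt (B / A), by positivity, Real.sqrt_le_one.2 hAB, ht0,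
    Real.sqrt_le_one.2 ((div_le_one hA0).2 hBA), ?_⟩
  rw [hst, wedgeRate, ← ha, ← hb, ← hA, ← hBeq]
  have e : Real.sqrt (A * B) + Real.sqrt (B / A) = (1 + A) * Real.sqrt (B / A) := by
    rw [hsA]; ring
  rw [e, Real.log_mul (by positivity) ht0.ne', Real.log_sqrt (by positivity),
    Real.log_sqrt (by positivity), Real.log_mul hA0.ne' hB0.ne', Real.log_div hB0.ne' hA0.ne', ha, hb]
  ring

lemma eventually_card_wedge_le {α β γ : ℝ}
    (hα : 0 ≤ α ∧ α ≤ 1 / 2) (hβ : 0 ≤ β ∧ β ≤ 1 / 2) (hγ : 0 ≤ γ ∧ γ ≤ 1 / 2)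
    (hlow : |α - β| ≤ γ) (hupp : γ < α + β) (h : |α - β| ≤ γ * (1 - 2 * min α β))
    {δ : ℝ} (hδ : 0 < δ) :
    ∀ᶠ n : ℕ in atTop, ∀ v q : Vec n, hammingDist v q = ⌊γ * n⌋₊ →
      ((wedge α β v q).card : ℝ) ≤ Real.exp ((wedgeRate α β γ + δ) * n) := by
  obtain ⟨s, t, hs, hs1, ht, ht1, hst⟩ := exists_chernoff_parameters hα hβ hγ hlow hupp h
  have hlim : Tendsto (fun n : ℕ => -α * Real.log s - β * Real.log t +
      ((⌊γ * n⌋₊ : ℝ) / n * Real.log (s + t) + (1 - (⌊γ * n⌋₊ : ℝ) / n) * Real.log (1 + s * t)))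
      atTop (𝓝 (wedgeRate α β γ)) := by
    rw [← hst]
    have hD := tendsto_natFloor_mul_div hγ.1
    exact ((hD.mul_const _).add ((hD.const_sub 1).mul_const _)).const_add _
  filter_upwards [hlim.eventually_le_const (lt_add_of_pos_right _ hδ), eventually_ge_atTop 1] with
    n hn hn1 v q hvq
  have hn0 : (0 : ℝ) < n := by exact_mod_cast hn1
  refine (card_wedge_le hs hs1 ht ht1 v q).trans ?_
  have hst1 : 0 < 1 + s * t := by positivity
  have hDn : hammingDist v q ≤ n := by simpa using hammingDist_le_card_fintype (x := v) (y := q)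
  rw [← Real.rpow_natCast, ← Real.rpow_natCast (1 + s * t), Nat.cast_sub hDn, hvq,
    Real.rpow_def_of_pos hs, Real.rpow_def_of_pos ht, Real.rpow_def_of_pos (by positivity),
    Real.rpow_def_of_pos hst1, ← Real.exp_add, ← Real.exp_add, ← Real.exp_add, Real.exp_le_exp]
  refine (le_of_eq ?_).trans (mul_le_mul_of_nonneg_right hn hn0.le)
  field_simp
  ring

end LSF

theorem mainTheorem2 (α β γ : ℝ)
    (hα : 0 ≤ α ∧ α ≤ 1 / 2) (hβ : 0 ≤ β ∧ β ≤ 1 / 2) (hγ : 0 ≤ γ ∧ γ ≤ 1 / 2)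
    (hlow : |α - β| ≤ γ) (hupp : γ < α + β) :
    IsProbVector (balancedTriple α β γ) ∧ IsProbVector (balancedPair γ) ∧
    -- this many filter vectors suffice, for all distances up to `γ n`
    (∃ M : ℕ → ℕ,
      Tendsto (fun n : ℕ => Real.logb 2 (M n) / n) atTop (𝓝 (filterExponent α β γ)) ∧
      ∀ K : ℝ, ∀ᶠ n : ℕ in atTop, ∀ (L : List (LSF.Vec n)) (q : LSF.Vec n),
        LSF.prob {C : Fin (M n) → LSF.Vec n |
          ¬ ∀ v ∈ L, LSF.Close γ v q → v ∈ LSF.query β γ C (LSF.preprocess α C L) q}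
            ≤ (2 : ℝ) ^ (-(K * n))) ∧
    -- exponentially fewer filter vectors do not suffice, when neither `α` nor `β` is wastefully large
    (|α - β| ≤ γ * (1 - 2 * min α β) →
      ∀ ε : ℝ, 0 < ε → ∀ᶠ n : ℕ in atTop, ∀ M : ℕ,
        (M : ℝ) ≤ (2 : ℝ) ^ ((filterExponent α β γ - ε) * n) →
        ∀ (L : List (LSF.Vec n)) (v q : LSF.Vec n), v ∈ L → hammingDist v q = ⌊γ * n⌋₊ →
          LSF.prob {C : Fin M → LSF.Vec n | v ∈ LSF.query β γ C (LSF.preprocess α C L) q}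
            ≤ (2 : ℝ) ^ (-(ε / 2 * n))) := by
  refine ⟨isProbVector_balancedTriple hα.2 hβ.2 hlow hupp, isProbVector_balancedPair hγ, ?_, ?_⟩
  · obtain ⟨T, hT0, hT2, hTlim, hT⟩ := LSF.exists_le_card_wedge α β γ hα.2 hβ.2 hγ hlow hupp
    refine ⟨LSF.numFilters T, ?_, fun K => ?_⟩
    · rw [filterExponent_eq]
      exact LSF.tendsto_logb_numFilters hT0 hT2 hTlim
    · filter_upwards [hT, LSF.eventually_two_pow_mul_exp_neg_sq_le K] with n hn hK L q
      exact (LSF.prob_miss_numFilters_le (hT0 n) hn L q).trans hK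
  · intro h ε hε
    have hl2 : 0 < Real.log 2 := Real.log_pos (by norm_num)
    -- Half of `ε` pays for the slack in the wedge bound; the other half remains as the decay rate.
    filter_upwards [LSF.eventually_card_wedge_le hα hβ hγ hlow hupp h
      (show 0 < ε / 2 * Real.log 2 by positivity)] with n hn M hM L v q _ hvq
    calc _ ≤ M * (((LSF.wedge α β v q).card : ℝ) / 2 ^ n) := LSF.prob_hit_le L v q
      _ ≤ (2 : ℝ) ^ ((filterExponent α β γ - ε) * n) *
          (Real.exp ((wedgeRate α β γ + ε / 2 * Real.log 2) * n) / 2 ^ n) := by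
        gcongr
        exact hn v q hvq
      _ = (2 : ℝ) ^ (-(ε / 2 * n)) := by
        rw [filterExponent_eq, ← Real.rpow_natCast 2 n, Real.rpow_def_of_pos (by norm_num),
          Real.rpow_def_of_pos (by norm_num), Real.rpow_def_of_pos (by norm_num), ← Real.exp_sub,
          ← Real.exp_add]
        congr 1
        field_simp
        ring
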